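/- Let $x$ be a random vector in $\mathbb{R}^p$, $p\ge 1$, with an elliptical distribution $\mathcal{E}_p(\mu,M,g)$, that is, with a Lebesgue density of the form $$f(x)=C\,|M|^{-1/2}\,g\big((x-\mu)^\top M^{-1}(x-\mu)\big),$$ where $g:[0,\infty)\to[0,\infty)$ is measurable, $C>0$ is a normalizing constant, $\mu=\mathbb{E}[x]$, and $g$ is scaled so that the positive definite matrix $M$ is the covariance matrix of $x$. Assume that $x$ has finite fourth order moments, and let $$\kappa=\frac{\mathbb{E}[r^4]}{p(p+2)}-1,\qquad r^2=(x-\mu)^\top M^{-1}(x-\mu),$$ be its elliptical kurtosis parameter. Let $x_1,\dots,x_n$, $n\ge 3$, be an i.i.d. sample from this distribution, with sample mean $\bar x=\frac1n\sum_{i=1}^n x_i$ and sample covariance matrix $S=\frac{1}{n-1}\sum_{i=1}^n (x_i-\bar x)(x_i-\bar x)^\top$. Put $$\hat\vartheta=b_n\left(\frac{\mathrm{tr}(S^2)}{p}-a_n\,\frac{p}{n}\left[\frac{\mathrm{tr}(S)}{p}\right]^2\right),$$ $$a_n=\frac{n}{n+\kappa}\left(\frac{n}{n-1}+\kappa\right),\qquad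 b_n=\frac{(\kappa+n)(n-1)^2}{(n-2)\big(3\kappa(n-1)+n(n+1)\big)}.$$ (a) For all $n\ge 3$ and $p\ge 1$, $\hat\vartheta$ is integrable and is an unbiased estimator of $\vartheta=\mathrm{tr}(M^2)/p$: $\mathbb{E}[\hat\vartheta]=\vartheta$. (b) Consider a sequence of such samples along which $n,p\to\infty$ and $p/n\to c_0\in\mathbb{R}$ (where $\mu$, $M$, $g$, and hence $\kappa$, may change along the sequence), and suppose that $\mathrm{tr}(M^i)/p$ has a finite and positive limit for $i=1,2,3,4$. Then $\hat\vartheta$ is asymptotically unbiased: $\mathbb{E}[\hat\vartheta]\to\vartheta_o$, where $\vartheta_o>0$ is the limit of $\vartheta=\mathrm{tr}(M^2)/p$. -/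

import Mathlib

open MeasureTheory ProbabilityTheory Filter Topology
open scoped Matrix NNReal ENNReal

namespace EllipticalSCM

noncomputable section

/-- The quadratic form `r² = (x - μ)ᵀ M⁻¹ (x - μ)`, the square of the generating variate. -/
def radiusSq {p : ℕ} (μ : Fin p → ℝ) (M : Matrix (Fin p) (Fin p) ℝ) (x : Fin p → ℝ) : ℝ :=
  (x - μ) ⬝ᵥ (M⁻¹ *ᵥ (x - μ))

/-- `ν` is the elliptical distribution `𝓔_p(μ, M, g)`: the probability measure on `ℝ^p` with
Lebesgue density `C |M|^{-1/2} g((x - μ)ᵀ M⁻¹ (x - μ))` for a normalizing constant `C`, where the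
density generator `g : [0, ∞) → [0, ∞)` is scaled in such a way that the positive definite
matrix `M` is the covariance matrix of `ν`; `μ` is the mean vector. -/
structure IsElliptical {p : ℕ} (ν : Measure (Fin p → ℝ)) (μ : Fin p → ℝ)
    (M : Matrix (Fin p) (Fin p) ℝ) (g : ℝ≥0 → ℝ≥0) : Prop where
  isProbabilityMeasure : IsProbabilityMeasure ν
  posDef : M.PosDef
  measurable_generator : Measurable g
  density : ∃ C : ℝ, 0 < C ∧ ν = (volume : Measure (Fin p → ℝ)).withDensity fun x =>
    ENNReal.ofReal (C * M.det ^ (-(1 / 2) : ℝ) * (g (radiusSq μ M x).toNNReal : ℝ))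
  mean : ∀ j, ∫ x, x j ∂ν = μ j
  covariance : ∀ j k, cov[fun x => x j, fun x => x k; ν] = M j k

/-- The elliptical kurtosis parameter `κ = E[r⁴] / (p (p + 2)) - 1`. -/
def ellipticalKurtosis {p : ℕ} (ν : Measure (Fin p → ℝ)) (μ : Fin p → ℝ)
    (M : Matrix (Fin p) (Fin p) ℝ) : ℝ :=
  (∫ x, radiusSq μ M x ^ 2 ∂ν) / ((p : ℝ) * ((p : ℝ) + 2)) - 1

/-- The random vectors `X 1, …, X n` are i.i.d. with common law `ν`. -/
structure IsIIDSample {Ω : Type*} [MeasurableSpace Ω] {n p : ℕ} (P : Measure Ω)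
    (X : Fin n → Ω → Fin p → ℝ) (ν : Measure (Fin p → ℝ)) : Prop where
  indep : iIndepFun X P
  hasLaw : ∀ i, HasLaw (X i) ν P

/-- The sample mean vector. -/
def sampleMean {n p : ℕ} (x : Fin n → Fin p → ℝ) : Fin p → ℝ :=
  (n : ℝ)⁻¹ • ∑ i, x i

/-- The sample covariance matrix `S = (n - 1)⁻¹ ∑ᵢ (xᵢ - x̄)(xᵢ - x̄)ᵀ`. -/
def sampleCov {n p : ℕ} (x : Fin n → Fin p → ℝ) : Matrix (Fin p) (Fin p) ℝ :=
  ((n : ℝ) - 1)⁻¹ • ∑ i, Matrix.vecMulVec (x i - sampleMean x) (x i - sampleMean x)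

/-- The constant `a_n`. -/
def aCoef (n : ℕ) (κ : ℝ) : ℝ :=
  ((n : ℝ) / ((n : ℝ) + κ)) * ((n : ℝ) / ((n : ℝ) - 1) + κ)

/-- The constant `b_n`. -/
def bCoef (n : ℕ) (κ : ℝ) : ℝ :=
  ((κ + (n : ℝ)) * ((n : ℝ) - 1) ^ 2) /
    (((n : ℝ) - 2) * (3 * κ * ((n : ℝ) - 1) + (n : ℝ) * ((n : ℝ) + 1)))

/-- The parameter `ϑ = tr(M²) / p`. -/
def theta {p : ℕ} (M : Matrix (Fin p) (Fin p) ℝ) : ℝ :=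
  (M ^ 2).trace / (p : ℝ)

/-- The statistic `b_n (tr(S²) / p - a_n (p / n) (tr(S) / p)²)`. -/
def thetaHat {n p : ℕ} (κ : ℝ) (x : Fin n → Fin p → ℝ) : ℝ :=
  bCoef n κ * ((sampleCov x ^ 2).trace / (p : ℝ)
    - aCoef n κ * ((p : ℝ) / (n : ℝ)) * ((sampleCov x).trace / (p : ℝ)) ^ 2)

end

end EllipticalSCM

/-! ### Second moments of a sample covariance matrix from independent observations. -/

namespace EllipticalSCM

/-! After centring at the mean, each entry of `S` is a quadratic form in the sample whose weights
are `(n - 1)⁻¹` times the projection orthogonal to the constants. For independent centred factors a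
fourth moment is the sum over the three pairings plus a cumulant when all indices agree, so `E[S_ab
S_cd]` is explicit (`integral_sampleCov_mul`).

Contracting indices to get `tr(S²)` and `tr(S)²`, the fourth moments of the law enter only through
`E|x - μ|⁴`. Ellipticity is needed here: with `M = A Aᵀ` and `Aᵀ A` diagonal, `|x - μ|² = ∑ dᵢ zᵢ²`
for the whitened vector `z`, whose law is rotation invariant. Invariance forces `E[zᵢ² zⱼ²] = m (1 +
2 δᵢⱼ)`, and the definition of `κ` gives `m = 1 + κ` (`IsElliptical.integral_sq_sum_sq`).

Both expectations are then linear in `s = (tr M)²` and `t = tr(M²)`. The constant `a_n` eliminates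
`s` and `b_n` normalizes the coefficient of `t`; `κ ≥ -2/3` keeps the denominators nonzero. Part (b)
follows since the expectation eventually equals `ϑ`. -/

/-- Mixed moments of order four of centered functions of independent coordinates. -/
lemma integral_pi_mul_mul_mul {n : ℕ} {E : Type*} [MeasurableSpace E] (ν : Measure E)
    [IsProbabilityMeasure ν] (f₁ f₂ f₃ f₄ : E → ℝ) (h₁ : ∫ y, f₁ y ∂ν = 0)
    (h₂ : ∫ y, f₂ y ∂ν = 0) (h₃ : ∫ y, f₃ y ∂ν = 0) (h₄ : ∫ y, f₄ y ∂ν = 0)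
    (i j k l : Fin n) :
    ∫ x : Fin n → E, f₁ (x i) * f₂ (x j) * (f₃ (x k) * f₄ (x l)) ∂(Measure.pi fun _ => ν) =
      (if i = j then 1 else 0) * (if k = l then 1 else 0)
          * ((∫ y, f₁ y * f₂ y ∂ν) * ∫ y, f₃ y * f₄ y ∂ν)
        + (if i = k then 1 else 0) * (if j = l then 1 else 0)
          * ((∫ y, f₁ y * f₃ y ∂ν) * ∫ y, f₂ y * f₄ y ∂ν)
        + (if i = l then 1 else 0) * (if j = k then 1 else 0)
          * ((∫ y, f₁ y * f₄ y ∂ν) * ∫ y, f₂ y * f₃ y ∂ν)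
        + (if i = j then 1 else 0) * (if j = k then 1 else 0) * (if k = l then 1 else 0)
          * ((∫ y, f₁ y * f₂ y * (f₃ y * f₄ y) ∂ν)
            - (∫ y, f₁ y * f₂ y ∂ν) * (∫ y, f₃ y * f₄ y ∂ν)
            - (∫ y, f₁ y * f₃ y ∂ν) * (∫ y, f₂ y * f₄ y ∂ν)
            - (∫ y, f₁ y * f₄ y ∂ν) * ∫ y, f₂ y * f₃ y ∂ν) := by
  -- `F m` collects the factors evaluated at coordinate `m`, so the integral splits into a product
  -- over `m`. The case split runs over coincidence patterns of the indices: an index occurring only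
  -- once gives a zero factor by centring.
  set F : Fin n → E → ℝ := fun m y => (if m = i then f₁ y else 1) * (if m = j then f₂ y else 1)
    * ((if m = k then f₃ y else 1) * (if m = l then f₄ y else 1)) with hF
  have hprod : ∫ x : Fin n → E, f₁ (x i) * f₂ (x j) * (f₃ (x k) * f₄ (x l))
      ∂(Measure.pi fun _ => ν) = ∏ m, ∫ y, F m y ∂ν := by
    rw [← integral_fintype_prod_eq_prod]
    congr 1
    ext x
    simp only [hF, Finset.prod_mul_distrib, Finset.prod_ite_eq', Finset.mem_univ, if_true]
  have hzero : ∀ m, ∫ y, F m y ∂ν = 0 → ∏ m, ∫ y, F m y ∂ν = 0 :=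
    fun m hm => Finset.prod_eq_zero (Finset.mem_univ m) hm
  have htwo : ∀ a b, a ≠ b → (∀ m, m ≠ a → m ≠ b → ∫ y, F m y ∂ν = 1) →
      ∏ m, ∫ y, F m y ∂ν = (∫ y, F a y ∂ν) * ∫ y, F b y ∂ν := fun a b hab h =>
    Finset.prod_eq_mul a b hab (fun m _ hm => h m hm.1 hm.2) (by simp) (by simp)
  have hone : ∀ a, (∀ m, m ≠ a → ∫ y, F m y ∂ν = 1) →
      ∏ m, ∫ y, F m y ∂ν = (∫ y, F a y ∂ν) := fun a h =>
    Finset.prod_eq_single a (fun m _ hm => h m hm) (by simp)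
  rw [hprod]
  by_cases hij : i = j
  · subst hij
    by_cases hkl : k = l
    · subst hkl
      by_cases hik : i = k
      · subst hik
        rw [hone i (fun m hm => by simp [hF, hm])]
        simp [hF]
      · rw [htwo i k hik (fun m h h' => by simp [hF, h, h'])]
        simp [hF, hik, Ne.symm hik]
    · by_cases hik : i = k
      · subst hik
        rw [hzero l (by simp [hF, Ne.symm hkl, h₄])]
        simp [hkl]
      · rw [hzero k (by simp [hF, hkl, Ne.symm hik, h₃])]
        simp [hkl, hik]
  · by_cases hik : i = k
    · subst hik
      by_cases hjl : j = l
      · subst hjl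
        rw [htwo i j hij (fun m h h' => by simp [hF, h, h'])]
        simp [hF, hij, Ne.symm hij]
      · rw [hzero j (by simp [hF, Ne.symm hij, hjl, h₂])]
        simp [hij, Ne.symm hij, hjl]
    · by_cases hil : i = l
      · subst hil
        by_cases hjk : j = k
        · subst hjk
          rw [htwo i j hij (fun m h h' => by simp [hF, h, h'])]
          simp [hF, hij, Ne.symm hij]
        · rw [hzero j (by simp [hF, Ne.symm hij, hjk, h₂])]
          simp [hij, hik, hjk]
      · rw [hzero i (by simp [hF, hij, hik, hil, h₁])]
        simp [hij, hik, hil]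

lemma integrable_mul_mul_mul {α : Type*} [MeasurableSpace α] {P : Measure α}
    {f₁ f₂ f₃ f₄ : α → ℝ} (h₁ : MemLp f₁ 4 P) (h₂ : MemLp f₂ 4 P) (h₃ : MemLp f₃ 4 P)
    (h₄ : MemLp f₄ 4 P) : Integrable (fun x => f₁ x * f₂ x * (f₃ x * f₄ x)) P := by
  have : ENNReal.HolderTriple 4 4 2 := ⟨by
    rw [← ENNReal.toReal_eq_toReal_iff' (by simp) (by simp),
      ENNReal.toReal_add (by simp) (by simp)]
    norm_num⟩
  have h12 : MemLp (fun x => f₁ x * f₂ x) 2 P := h₂.mul h₁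
  have h34 : MemLp (fun x => f₃ x * f₄ x) 2 P := h₄.mul h₃
  exact h12.integrable_mul h34

/-- The weights of the sample covariance matrix as a quadratic form in the sample. -/
noncomputable def covWeight (n : ℕ) (i j : Fin n) : ℝ :=
  ((n : ℝ) - 1)⁻¹ * ((if i = j then 1 else 0) - (n : ℝ)⁻¹)

/-- Subtracting the sample mean removes any shift, so `μ` is arbitrary: `0` suffices for
integrability, while the true mean is used to compute moments. -/
lemma sampleCov_apply_eq_sum {n p : ℕ} (hn : 2 ≤ n) (x : Fin n → Fin p → ℝ) (μ : Fin p → ℝ)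
    (a b : Fin p) :
    sampleCov x a b = ∑ i, ∑ j, covWeight n i j * ((x i a - μ a) * (x j b - μ b)) := by
  have hn0 : (n : ℝ) ≠ 0 := by positivity
  have key : ∀ u v : Fin n → ℝ,
      ∑ i, (u i - (n : ℝ)⁻¹ * ∑ m, u m) * (v i - (n : ℝ)⁻¹ * ∑ m, v m)
        = ∑ i, u i * v i - (n : ℝ)⁻¹ * ((∑ i, u i) * ∑ j, v j) := by
    intro u v
    simp only [sub_mul, mul_sub, Finset.sum_sub_distrib, ← Finset.sum_mul, ← Finset.mul_sum]
    simp
    field_simp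
    ring
  have hm : ∀ i c, (x i - sampleMean x) c
      = (x i c - μ c) - (n : ℝ)⁻¹ * ∑ m, (x m c - μ c) := by
    intro i c
    simp [sampleMean, Finset.sum_apply, mul_sub]
    field_simp
    ring
  have h1 : sampleCov x a b = ((n : ℝ) - 1)⁻¹ *
      (∑ i, (x i a - μ a) * (x i b - μ b)
        - (n : ℝ)⁻¹ * ((∑ i, (x i a - μ a)) * ∑ j, (x j b - μ b))) := by
    rw [← key]
    simp only [sampleCov, Matrix.smul_apply, Matrix.sum_apply, Matrix.vecMulVec_apply, hm,
      smul_eq_mul]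
  rw [h1]
  simp only [covWeight, mul_assoc, ← Finset.mul_sum, sub_mul, Finset.sum_sub_distrib, ite_mul,
    one_mul, zero_mul, Finset.sum_ite_eq, Finset.mem_univ, if_true, Finset.sum_mul]

/-- The weight matrix is `(n - 1)⁻¹` times a projection of rank `n - 1`, which explains its trace
and Frobenius norm; its diagonal entries all equal `1/n`. These three sums are the coefficients of
the moment formula. -/
lemma sum_covWeight_self {n : ℕ} (hn : 2 ≤ n) : ∑ i, covWeight n i i = 1 := by
  have h0 : (n : ℝ) ≠ 0 := by positivity
  have h1 : (n : ℝ) - 1 ≠ 0 := by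
    have : (2 : ℝ) ≤ n := by exact_mod_cast hn
    linarith
  simp [covWeight]
  field_simp

lemma sum_covWeight_sq {n : ℕ} (hn : 2 ≤ n) :
    ∑ i, ∑ j, covWeight n i j * covWeight n i j = ((n : ℝ) - 1)⁻¹ := by
  have h0 : (n : ℝ) ≠ 0 := by positivity
  have h1 : (n : ℝ) - 1 ≠ 0 := by
    have : (2 : ℝ) ≤ n := by exact_mod_cast hn
    linarith
  have : ∀ i j : Fin n, covWeight n i j * covWeight n i j = (((n : ℝ) - 1)⁻¹) ^ 2 *
      ((if i = j then 1 else 0) * (1 - 2 * (n : ℝ)⁻¹) + (n : ℝ)⁻¹ ^ 2) := by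
    intro i j
    unfold covWeight
    split_ifs <;> ring
  simp only [this, ← Finset.mul_sum, Finset.sum_add_distrib, ← Finset.sum_mul,
    Finset.sum_ite_eq]
  simp
  field_simp
  ring

lemma sum_covWeight_self_sq {n : ℕ} (hn : 2 ≤ n) :
    ∑ i, covWeight n i i * covWeight n i i = (n : ℝ)⁻¹ := by
  have h0 : (n : ℝ) ≠ 0 := by positivity
  have h1 : (n : ℝ) - 1 ≠ 0 := by
    have : (2 : ℝ) ≤ n := by exact_mod_cast hn
    linarith
  simp [covWeight]
  field_simp

lemma covWeight_comm {n : ℕ} (i j : Fin n) : covWeight n i j = covWeight n j i := by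
  simp [covWeight, eq_comm]

section Moments

variable {n p : ℕ} {ν : Measure (Fin p → ℝ)} [IsProbabilityMeasure ν] {μ : Fin p → ℝ}

lemma memLp_coord_sub (h4 : MemLp id 4 ν) (a : Fin p) :
    MemLp (fun x : Fin p → ℝ => x a - μ a) 4 ν :=
  ((memLp_pi_iff.1 h4) a).sub (memLp_const _)

lemma memLp_pi_coord_sub (h4 : MemLp id 4 ν) (i : Fin n) (a : Fin p) :
    MemLp (fun x : Fin n → Fin p → ℝ => x i a - μ a) 4 (Measure.pi fun _ => ν) :=
  (memLp_coord_sub h4 a).comp_measurePreserving (measurePreserving_eval (fun _ => ν) i)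

lemma integrable_sampleCov_mul (hn : 2 ≤ n) (h4 : MemLp id 4 ν) (a b c d : Fin p) :
    Integrable (fun x : Fin n → Fin p → ℝ => sampleCov x a b * sampleCov x c d)
      (Measure.pi fun _ => ν) := by
  simp only [sampleCov_apply_eq_sum hn _ (0 : Fin p → ℝ), Finset.sum_mul_sum]
  refine integrable_finsetSum _ fun i _ => integrable_finsetSum _ fun k _ =>
    integrable_finsetSum _ fun j _ => integrable_finsetSum _ fun l _ => ?_
  have := (integrable_mul_mul_mul (memLp_pi_coord_sub (μ := 0) h4 i a)
    (memLp_pi_coord_sub (μ := 0) h4 j b) (memLp_pi_coord_sub (μ := 0) h4 k c)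
    (memLp_pi_coord_sub (μ := 0) h4 l d)).const_mul (covWeight n i j * covWeight n k l)
  refine this.congr (ae_of_all _ fun x => ?_)
  ring

/-- Second moments of the entries of the sample covariance matrix. -/
lemma integral_sampleCov_mul (hn : 2 ≤ n) (h4 : MemLp id 4 ν) {M : Matrix (Fin p) (Fin p) ℝ}
    (hmean : ∀ a, ∫ x, x a - μ a ∂ν = 0)
    (hcov : ∀ a b, ∫ x, (x a - μ a) * (x b - μ b) ∂ν = M a b) (a b c d : Fin p) :
    ∫ x : Fin n → Fin p → ℝ, sampleCov x a b * sampleCov x c d ∂(Measure.pi fun _ => ν) =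
      M a b * M c d + ((n : ℝ) - 1)⁻¹ * (M a c * M b d + M a d * M b c)
        + (n : ℝ)⁻¹ * ((∫ x, (x a - μ a) * (x b - μ b) * ((x c - μ c) * (x d - μ d)) ∂ν)
          - M a b * M c d - M a c * M b d - M a d * M b c) := by
  have hexp : ∀ x : Fin n → Fin p → ℝ, sampleCov x a b * sampleCov x c d =
      ∑ i, ∑ j, ∑ k, ∑ l, covWeight n i j * covWeight n k l *
        ((x i a - μ a) * (x j b - μ b) * ((x k c - μ c) * (x l d - μ d))) := by
    intro x
    rw [sampleCov_apply_eq_sum hn x μ a b, sampleCov_apply_eq_sum hn x μ c d, Finset.sum_mul]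
    refine Finset.sum_congr rfl fun i _ => ?_
    rw [Finset.sum_mul]
    refine Finset.sum_congr rfl fun j _ => ?_
    rw [Finset.mul_sum]
    refine Finset.sum_congr rfl fun k _ => ?_
    rw [Finset.mul_sum]
    refine Finset.sum_congr rfl fun l _ => ?_
    ring
  have hint : ∀ i j k l : Fin n, Integrable (fun x : Fin n → Fin p → ℝ =>
      covWeight n i j * covWeight n k l *
        ((x i a - μ a) * (x j b - μ b) * ((x k c - μ c) * (x l d - μ d))))
        (Measure.pi fun _ => ν) := fun i j k l =>
    (integrable_mul_mul_mul (memLp_pi_coord_sub h4 i a) (memLp_pi_coord_sub h4 j b)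
      (memLp_pi_coord_sub h4 k c) (memLp_pi_coord_sub h4 l d)).const_mul _
  have hterm := fun i j k l : Fin n => integral_pi_mul_mul_mul ν (fun y : Fin p → ℝ => y a - μ a)
    (fun y => y b - μ b) (fun y => y c - μ c) (fun y => y d - μ d)
    (hmean a) (hmean b) (hmean c) (hmean d) i j k l
  simp only [hcov] at hterm
  simp only [hexp]
  rw [integral_finsetSum _ fun i _ => integrable_finsetSum _ fun j _ =>
    integrable_finsetSum _ fun k _ => integrable_finsetSum _ fun l _ => hint i j k l]
  have hE : ∀ i, ∫ x : Fin n → Fin p → ℝ, ∑ j, ∑ k, ∑ l, covWeight n i j * covWeight n k l *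
        ((x i a - μ a) * (x j b - μ b) * ((x k c - μ c) * (x l d - μ d)))
        ∂(Measure.pi fun _ => ν) =
      ∑ j, ∑ k, ∑ l, covWeight n i j * covWeight n k l *
        ∫ x : Fin n → Fin p → ℝ, (x i a - μ a) * (x j b - μ b) * ((x k c - μ c) * (x l d - μ d))
          ∂(Measure.pi fun _ => ν) := by
    intro i
    rw [integral_finsetSum _ fun j _ => integrable_finsetSum _ fun k _ =>
      integrable_finsetSum _ fun l _ => hint i j k l]
    refine Finset.sum_congr rfl fun j _ => ?_
    rw [integral_finsetSum _ fun k _ => integrable_finsetSum _ fun l _ => hint i j k l]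
    refine Finset.sum_congr rfl fun k _ => ?_
    rw [integral_finsetSum _ fun l _ => hint i j k l]
    exact Finset.sum_congr rfl fun l _ => integral_const_mul _ _
  simp only [hE, hterm]
  generalize (∫ x, (x a - μ a) * (x b - μ b) * ((x c - μ c) * (x d - μ d)) ∂ν)
    - M a b * M c d - M a c * M b d - M a d * M b c = K
  generalize M a b * M c d = A
  generalize M a c * M b d = B
  generalize M a d * M b c = C
  simp only [mul_add, Finset.sum_add_distrib]
  have e1 : ∑ i, ∑ j, ∑ k, ∑ l, covWeight n i j * covWeight n k l *
      ((if i = j then 1 else 0) * (if k = l then 1 else 0) * A) = A := by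
    have : ∑ i, ∑ j, ∑ k, ∑ l, covWeight n i j * covWeight n k l *
        ((if i = j then 1 else 0) * (if k = l then 1 else 0) * A) =
        (∑ i, covWeight n i i) * (∑ k, covWeight n k k) * A := by
      simp only [Finset.sum_mul, Finset.mul_sum]
      simp
      exact Finset.sum_comm
    rw [this, sum_covWeight_self hn]
    ring
  have e2 : ∑ i, ∑ j, ∑ k, ∑ l, covWeight n i j * covWeight n k l *
      ((if i = k then 1 else 0) * (if j = l then 1 else 0) * B) = ((n : ℝ) - 1)⁻¹ * B := by
    rw [← sum_covWeight_sq hn]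
    simp [Finset.sum_mul]
  have e3 : ∑ i, ∑ j, ∑ k, ∑ l, covWeight n i j * covWeight n k l *
      ((if i = l then 1 else 0) * (if j = k then 1 else 0) * C) = ((n : ℝ) - 1)⁻¹ * C := by
    rw [← sum_covWeight_sq hn]
    simp [Finset.sum_mul, covWeight_comm]
  have e4 : ∑ i, ∑ j, ∑ k, ∑ l, covWeight n i j * covWeight n k l *
      ((if i = j then 1 else 0) * (if j = k then 1 else 0) * (if k = l then 1 else 0) * K)
      = (n : ℝ)⁻¹ * K := by
    rw [← sum_covWeight_self_sq hn]
    simp [Finset.sum_mul]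
  rw [e1, e2, e3, e4]
  ring

end Moments

end EllipticalSCM

/-! ### Whitening and plane reflections. -/

namespace EllipticalSCM

section Factor

variable {p : ℕ}

/-- A positive definite matrix factors as `A Aᵀ` where `A` has orthogonal columns. -/
lemma exists_factor_of_posDef {M : Matrix (Fin p) (Fin p) ℝ} (hM : M.PosDef) :
    ∃ (A : Matrix (Fin p) (Fin p) ℝ) (d : Fin p → ℝ),
      A * Aᵀ = M ∧ Aᵀ * A = Matrix.diagonal d := by
  set U : Matrix (Fin p) (Fin p) ℝ := hM.isHermitian.eigenvectorUnitary.1 with hU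
  have hUU : Uᵀ * U = 1 := by
    have := Unitary.coe_star_mul_self hM.isHermitian.eigenvectorUnitary
    simpa [Matrix.star_eq_conjTranspose, Matrix.conjTranspose_eq_transpose_of_trivial] using this
  have hs : Matrix.diagonal (fun i => √(hM.isHermitian.eigenvalues i))
      * Matrix.diagonal (fun i => √(hM.isHermitian.eigenvalues i))
      = Matrix.diagonal hM.isHermitian.eigenvalues := by
    rw [Matrix.diagonal_mul_diagonal]
    congr 1
    ext i
    exact Real.mul_self_sqrt (hM.eigenvalues_pos i).le
  have hspec : M = U * Matrix.diagonal hM.isHermitian.eigenvalues * Uᵀ := by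
    conv_lhs => rw [hM.isHermitian.spectral_theorem]
    simp [Unitary.conjStarAlgAut_apply, hU, Matrix.star_eq_conjTranspose,
      Matrix.conjTranspose_eq_transpose_of_trivial]
  -- No final factor `Uᵀ`, unlike the symmetric square root: this makes `Aᵀ A` the diagonal of
  -- eigenvalues.
  refine ⟨U * Matrix.diagonal fun i => √(hM.isHermitian.eigenvalues i),
    hM.isHermitian.eigenvalues, ?_, ?_⟩
  · conv_rhs => rw [hspec, ← hs]
    simp only [Matrix.transpose_mul, Matrix.diagonal_transpose, Matrix.mul_assoc]
  · rw [Matrix.transpose_mul, Matrix.diagonal_transpose, Matrix.mul_assoc, ← Matrix.mul_assoc Uᵀ,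
      hUU, Matrix.one_mul, hs]

lemma isUnit_det_of_mul_transpose {A M : Matrix (Fin p) (Fin p) ℝ} (hM : M.PosDef)
    (hA : A * Aᵀ = M) : IsUnit A.det := by
  have h := hM.det_pos
  rw [← hA, Matrix.det_mul, Matrix.det_transpose] at h
  exact isUnit_iff_ne_zero.2 fun h0 => by simp [h0] at h

/-- The coordinates of `x - μ` in the basis given by the columns of `A`. -/
noncomputable def whiten (A : Matrix (Fin p) (Fin p) ℝ) (μ x : Fin p → ℝ) : Fin p → ℝ :=
  A⁻¹ *ᵥ (x - μ)

lemma mulVec_whiten {A : Matrix (Fin p) (Fin p) ℝ} (hA : IsUnit A.det) (μ x : Fin p → ℝ) :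
    A *ᵥ whiten A μ x = x - μ := by
  rw [whiten, Matrix.mulVec_mulVec, Matrix.mul_nonsing_inv _ hA, Matrix.one_mulVec]

lemma measurable_whiten (A : Matrix (Fin p) (Fin p) ℝ) (μ : Fin p → ℝ) :
    Measurable (whiten A μ) := by
  unfold whiten
  fun_prop

lemma radiusSq_eq_whiten {A M : Matrix (Fin p) (Fin p) ℝ} (hA : A * Aᵀ = M) (μ x : Fin p → ℝ) :
    radiusSq μ M x = whiten A μ x ⬝ᵥ whiten A μ x := by
  rw [radiusSq, whiten, ← hA, Matrix.mul_inv_rev, ← Matrix.mulVec_mulVec,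
    ← Matrix.transpose_nonsing_inv, Matrix.dotProduct_mulVec, Matrix.vecMul_transpose]

lemma sum_sq_eq_whiten {A : Matrix (Fin p) (Fin p) ℝ} {d : Fin p → ℝ} (hA : IsUnit A.det)
    (hd : Aᵀ * A = Matrix.diagonal d) (μ x : Fin p → ℝ) :
    ∑ a, (x a - μ a) ^ 2 = ∑ i, d i * whiten A μ x i ^ 2 := by
  have h : ∑ a, (x a - μ a) ^ 2 = (x - μ) ⬝ᵥ (x - μ) := by
    simp [dotProduct, sq]
  rw [h, ← mulVec_whiten hA μ x, Matrix.dotProduct_mulVec, Matrix.vecMul_mulVec, hd]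
  simp only [dotProduct, Matrix.vecMul_diagonal]
  exact Finset.sum_congr rfl fun i _ => by ring

lemma dotProduct_mulVec_self_of_orthogonal {R : Matrix (Fin p) (Fin p) ℝ} (hR : Rᵀ * R = 1)
    (z : Fin p → ℝ) : (R *ᵥ z) ⬝ᵥ (R *ᵥ z) = z ⬝ᵥ z := by
  rw [Matrix.dotProduct_mulVec, Matrix.vecMul_mulVec, hR, Matrix.vecMul_one]

lemma abs_det_of_orthogonal {R : Matrix (Fin p) (Fin p) ℝ} (hR : Rᵀ * R = 1) : |R.det| = 1 := by
  have h : R.det * R.det = 1 := by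
    simpa [Matrix.det_mul] using congrArg Matrix.det hR
  rcases mul_self_eq_one_iff.1 h with h | h <;> simp [h]

end Factor

section Reflection

variable {p : ℕ}

/-- The Householder reflection along `α eᵢ + β eⱼ`. -/
noncomputable def planeReflection (i j : Fin p) (α β : ℝ) : Matrix (Fin p) (Fin p) ℝ :=
  1 - (2 / (α ^ 2 + β ^ 2)) • Matrix.vecMulVec (Pi.single i α + Pi.single j β)
    (Pi.single i α + Pi.single j β)

lemma planeReflection_orthogonal {i j : Fin p} (hij : i ≠ j) {α β : ℝ} (h : α ^ 2 + β ^ 2 ≠ 0) :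
    (planeReflection i j α β)ᵀ * planeReflection i j α β = 1 := by
  have hv : (Pi.single i α + Pi.single j β : Fin p → ℝ) ⬝ᵥ (Pi.single i α + Pi.single j β)
      = α ^ 2 + β ^ 2 := by
    simp [hij, Ne.symm hij, sq]
  unfold planeReflection
  generalize (Pi.single i α + Pi.single j β : Fin p → ℝ) = v at hv
  rw [Matrix.transpose_sub, Matrix.transpose_smul, Matrix.transpose_vecMulVec, Matrix.transpose_one,
    Matrix.sub_mul, Matrix.one_mul, Matrix.mul_sub, Matrix.mul_one, smul_mul_smul_comm,
    Matrix.vecMulVec_mul_vecMulVec, hv, Matrix.vecMulVec_smul, smul_smul]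
  have : 2 / (α ^ 2 + β ^ 2) * (2 / (α ^ 2 + β ^ 2)) * (α ^ 2 + β ^ 2)
      = 2 / (α ^ 2 + β ^ 2) + 2 / (α ^ 2 + β ^ 2) := by
    field_simp
    ring
  rw [this, add_smul]
  abel

lemma planeReflection_mulVec_left {i j : Fin p} (hij : i ≠ j) (α β : ℝ) (z : Fin p → ℝ) :
    (planeReflection i j α β *ᵥ z) i
      = z i - 2 / (α ^ 2 + β ^ 2) * (α * z i + β * z j) * α := by
  simp [planeReflection, Matrix.sub_mulVec, Matrix.smul_mulVec, Matrix.vecMulVec_mulVec, hij,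
    add_dotProduct]
  ring

lemma planeReflection_mulVec_right {i j : Fin p} (hij : i ≠ j) (α β : ℝ) (z : Fin p → ℝ) :
    (planeReflection i j α β *ᵥ z) j
      = z j - 2 / (α ^ 2 + β ^ 2) * (α * z i + β * z j) * β := by
  simp [planeReflection, Matrix.sub_mulVec, Matrix.smul_mulVec, Matrix.vecMulVec_mulVec,
    Ne.symm hij, add_dotProduct]
  ring

end Reflection

/-! ### Rotation invariance and fourth moments of elliptical laws. -/

section Elliptical

variable {p : ℕ} {ν : Measure (Fin p → ℝ)} {μ : Fin p → ℝ} {M : Matrix (Fin p) (Fin p) ℝ}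
  {g : ℝ≥0 → ℝ≥0}

lemma measurable_radiusSq (μ : Fin p → ℝ) (M : Matrix (Fin p) (Fin p) ℝ) :
    Measurable (radiusSq μ M) := by
  unfold radiusSq dotProduct Matrix.mulVec dotProduct
  fun_prop

/-- Whitened elliptical vectors have a rotation invariant distribution. -/
lemma IsElliptical.integral_comp_orthogonal (h : IsElliptical ν μ M g)
    {A : Matrix (Fin p) (Fin p) ℝ} (hA : A * Aᵀ = M) {R : Matrix (Fin p) (Fin p) ℝ}
    (hR : Rᵀ * R = 1) {f : (Fin p → ℝ) → ℝ} (hf : Measurable f) :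
    ∫ x, f (R *ᵥ whiten A μ x) ∂ν = ∫ x, f (whiten A μ x) ∂ν := by
  have hu : IsUnit A.det := isUnit_det_of_mul_transpose h.posDef hA
  obtain ⟨C, -, hν⟩ := h.density
  -- The map `T` is `R` seen in the original coordinates. The affine map it induces around `μ`
  -- preserves both volume and `radiusSq`, hence the density and `ν`.
  set T : Matrix (Fin p) (Fin p) ℝ := A * R * A⁻¹ with hT
  have hTdet : |T.det| = 1 := by
    rw [hT, Matrix.det_mul, Matrix.det_mul, Matrix.det_nonsing_inv, mul_right_comm,
      Ring.mul_inverse_cancel _ hu, one_mul, abs_det_of_orthogonal hR]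
  have hlin : MeasurePreserving (Matrix.toLin' T) volume volume := by
    refine ⟨(Matrix.toLin' T).continuous_of_finiteDimensional.measurable, ?_⟩
    rw [Real.map_matrix_volume_pi_eq_smul_volume_pi (fun h0 => by simp [h0] at hTdet), abs_inv,
      hTdet]
    simp
  set φ : (Fin p → ℝ) → Fin p → ℝ := fun x => Matrix.toLin' T (x - μ) + μ with hφ
  have hφp : MeasurePreserving φ volume volume :=
    (measurePreserving_add_right volume μ).comp
      (hlin.comp (measurePreserving_sub_right volume μ))
  have hw : ∀ x, whiten A μ (φ x) = R *ᵥ whiten A μ x := by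
    intro x
    simp only [whiten, hφ, hT, add_sub_cancel_right, Matrix.toLin'_apply, Matrix.mulVec_mulVec]
    rw [← Matrix.mul_assoc, ← Matrix.mul_assoc, Matrix.nonsing_inv_mul _ hu, Matrix.one_mul]
  have hr : ∀ x, radiusSq μ M (φ x) = radiusSq μ M x := by
    intro x
    rw [radiusSq_eq_whiten hA, radiusSq_eq_whiten hA, hw, dotProduct_mulVec_self_of_orthogonal hR]
  set ρ : (Fin p → ℝ) → ℝ≥0∞ := fun x =>
    ENNReal.ofReal (C * M.det ^ (-(1 / 2) : ℝ) * (g (radiusSq μ M x).toNNReal : ℝ)) with hρ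
  have hρm : Measurable ρ := by
    have := h.measurable_generator
    have := measurable_radiusSq μ M
    fun_prop
  have hmap : ν.map φ = ν := by
    ext s hs
    rw [Measure.map_apply hφp.measurable hs, hν, withDensity_apply _ (hφp.measurable hs),
      withDensity_apply _ hs, ← hφp.setLIntegral_comp_preimage hs hρm]
    simp only [hρ, hr]
  simp only [← hw]
  conv_rhs => rw [← hmap]
  exact (integral_map hφp.measurable.aemeasurable
    (hf.comp (measurable_whiten A μ)).aestronglyMeasurable).symm

lemma IsElliptical.memLp_whiten (h : IsElliptical ν μ M g) (h4 : MemLp id 4 ν)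
    (A : Matrix (Fin p) (Fin p) ℝ) (i : Fin p) : MemLp (fun x => whiten A μ x i) 4 ν := by
  have := h.isProbabilityMeasure
  simp only [whiten, Matrix.mulVec, dotProduct]
  exact memLp_finsetSum _ fun a _ => (memLp_coord_sub h4 a).const_mul _

/-- Fourth moments of the coordinates of a whitened elliptical vector. -/
lemma IsElliptical.exists_integral_sq_mul_sq (h : IsElliptical ν μ M g) (h4 : MemLp id 4 ν)
    {A : Matrix (Fin p) (Fin p) ℝ} (hA : A * Aᵀ = M) :
    ∃ m : ℝ, ∀ i j, ∫ x, whiten A μ x i ^ 2 * whiten A μ x j ^ 2 ∂ν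
      = m * (1 + 2 * if i = j then 1 else 0) := by
  have hL := h.memLp_whiten h4 A
  have hint : ∀ i j k l, Integrable (fun x => whiten A μ x i * whiten A μ x j *
      (whiten A μ x k * whiten A μ x l)) ν := fun i j k l =>
    integrable_mul_mul_mul (hL i) (hL j) (hL k) (hL l)
  have hswap : ∀ i j, i ≠ j → ∀ k : (ℝ × ℝ) → ℝ, Measurable k →
      ∫ x, k (whiten A μ x j, whiten A μ x i) ∂ν
        = ∫ x, k (whiten A μ x i, whiten A μ x j) ∂ν := by
    intro i j hij k hk
    -- The reflection along `eᵢ - eⱼ` exchanges the two coordinates.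
    have := h.integral_comp_orthogonal hA
      (planeReflection_orthogonal hij (α := 1) (β := -1) (by norm_num))
      (f := fun z => k (z i, z j)) (by fun_prop)
    simp only [planeReflection_mulVec_left hij, planeReflection_mulVec_right hij] at this
    rw [← this]
    congr 1
    ext x
    congr 2 <;> ring
  have hfour : ∀ i j, ∫ x, whiten A μ x i ^ 2 * whiten A μ x i ^ 2 ∂ν
      = ∫ x, whiten A μ x j ^ 2 * whiten A μ x j ^ 2 ∂ν := by
    intro i j
    by_cases hij : i = j
    · rw [hij]
    · exact (hswap i j hij (fun q => q.2 ^ 2 * q.2 ^ 2) (by fun_prop))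
  have hmixed : ∀ i j, i ≠ j → 3 * ∫ x, whiten A μ x i ^ 2 * whiten A μ x j ^ 2 ∂ν
      = ∫ x, whiten A μ x i ^ 2 * whiten A μ x i ^ 2 ∂ν := by
    intro i j hij
    have hodd := hswap i j hij (fun q => q.1 * q.1 * (q.1 * q.2)) (by fun_prop)
    -- The reflection along `eᵢ + 2 eⱼ` has rational entries `±3/5, ±4/5` in this plane. The odd
    -- terms it produces cancel by `hodd`, leaving `864 E[zᵢ² zⱼ²] = 288 E[zᵢ⁴]`.
    have hrot := h.integral_comp_orthogonal hA
      (planeReflection_orthogonal hij (α := 1) (β := 2) (by norm_num))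
      (f := fun z => z i ^ 2 * z j ^ 2) (by fun_prop)
    simp only [planeReflection_mulVec_left hij, planeReflection_mulVec_right hij] at hrot
    have hexp : ∀ x, (whiten A μ x i - 2 / (1 ^ 2 + 2 ^ 2) *
          (1 * whiten A μ x i + 2 * whiten A μ x j) * 1) ^ 2
        * (whiten A μ x j - 2 / (1 ^ 2 + 2 ^ 2) *
          (1 * whiten A μ x i + 2 * whiten A μ x j) * 2) ^ 2
        = 144 / 625 * (whiten A μ x i * whiten A μ x i * (whiten A μ x i * whiten A μ x i))
          + 144 / 625 * (whiten A μ x j * whiten A μ x j * (whiten A μ x j * whiten A μ x j))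
          + (-239) / 625 * (whiten A μ x i * whiten A μ x i * (whiten A μ x j * whiten A μ x j))
          + (-168) / 625 * (whiten A μ x i * whiten A μ x i * (whiten A μ x i * whiten A μ x j))
          + 168 / 625 * (whiten A μ x j * whiten A μ x j * (whiten A μ x j * whiten A μ x i)) := by
      intro x
      ring
    simp only [hexp] at hrot
    rw [integral_add, integral_add, integral_add, integral_add] at hrot
    · simp only [integral_const_mul] at hrot
      have hf := hfour i j
      simp only [sq] at hf hrot ⊢
      rw [hodd, ← hf] at hrot
      linarith
    all_goals
      first
      | exact (hint _ _ _ _).const_mul _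
      | exact ((hint _ _ _ _).const_mul _).add ((hint _ _ _ _).const_mul _)
      | exact (((hint _ _ _ _).const_mul _).add ((hint _ _ _ _).const_mul _)).add
          ((hint _ _ _ _).const_mul _)
      | exact ((((hint _ _ _ _).const_mul _).add ((hint _ _ _ _).const_mul _)).add
          ((hint _ _ _ _).const_mul _)).add ((hint _ _ _ _).const_mul _)
  rcases isEmpty_or_nonempty (Fin p) with hp | ⟨⟨i₀⟩⟩
  · exact ⟨0, fun i => hp.elim i⟩
  · refine ⟨(∫ x, whiten A μ x i₀ ^ 2 * whiten A μ x i₀ ^ 2 ∂ν) / 3, fun i j => ?_⟩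
    by_cases hij : i = j
    · subst hij
      rw [hfour i i₀]
      simp
      ring
    · have := hmixed i j hij
      rw [hfour i i₀] at this
      simp [hij]
      linarith

/-- The squared weighted norm of a whitened vector. -/
lemma integral_sq_sum_mul {α : Type*} [MeasurableSpace α] {P : Measure α} {Z : α → Fin p → ℝ}
    (hZ : ∀ i, MemLp (fun x => Z x i) 4 P) {m : ℝ}
    (hm : ∀ i j, ∫ x, Z x i ^ 2 * Z x j ^ 2 ∂P = m * (1 + 2 * if i = j then 1 else 0))
    (d : Fin p → ℝ) :
    ∫ x, (∑ i, d i * Z x i ^ 2) ^ 2 ∂P = m * ((∑ i, d i) ^ 2 + 2 * ∑ i, d i ^ 2) := by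
  have hint : ∀ i j, Integrable (fun x => d i * d j * (Z x i ^ 2 * Z x j ^ 2)) P := by
    intro i j
    have := (integrable_mul_mul_mul (hZ i) (hZ i) (hZ j) (hZ j)).const_mul (d i * d j)
    simpa only [sq] using this
  have hexp : ∀ x, (∑ i, d i * Z x i ^ 2) ^ 2
      = ∑ i, ∑ j, d i * d j * (Z x i ^ 2 * Z x j ^ 2) := by
    intro x
    rw [sq, Finset.sum_mul_sum]
    refine Finset.sum_congr rfl fun i _ => Finset.sum_congr rfl fun j _ => ?_
    ring
  simp only [hexp]
  rw [integral_finsetSum _ fun i _ => integrable_finsetSum _ fun j _ => hint i j]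
  have : ∀ i, ∫ x, ∑ j, d i * d j * (Z x i ^ 2 * Z x j ^ 2) ∂P
      = m * (d i * (∑ j, d j) + 2 * d i ^ 2) := by
    intro i
    rw [integral_finsetSum _ fun j _ => hint i j]
    simp only [integral_const_mul, hm, mul_add, Finset.sum_add_distrib]
    simp [Finset.mul_sum]
    congr 1
    · refine Finset.sum_congr rfl fun j _ => ?_
      ring
    · ring
  simp only [this, ← Finset.mul_sum, Finset.sum_add_distrib, ← Finset.sum_mul]
  ring

lemma IsElliptical.integral_sub_mean (h : IsElliptical ν μ M g) (h4 : MemLp id 4 ν) (a : Fin p) :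
    ∫ x, x a - μ a ∂ν = 0 := by
  have := h.isProbabilityMeasure
  have hi : Integrable (fun x : Fin p → ℝ => x a) ν :=
    ((memLp_pi_iff.1 h4) a).integrable (by norm_num)
  rw [integral_sub hi (integrable_const _), h.mean a]
  simp

lemma IsElliptical.integral_sub_mul_sub (h : IsElliptical ν μ M g) (a b : Fin p) :
    ∫ x, (x a - μ a) * (x b - μ b) ∂ν = M a b := by
  have hc := h.covariance a b
  unfold ProbabilityTheory.covariance at hc
  simpa only [h.mean] using hc

/-- The fourth moment of the norm in terms of the kurtosis parameter. -/
lemma IsElliptical.integral_sq_sum_sq (h : IsElliptical ν μ M g) (h4 : MemLp id 4 ν)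
    (hp : 1 ≤ p) :
    ∫ x, (∑ a, (x a - μ a) ^ 2) ^ 2 ∂ν
      = (1 + ellipticalKurtosis ν μ M) * (M.trace ^ 2 + 2 * (M ^ 2).trace) := by
  obtain ⟨A, d, hA, hd⟩ := exists_factor_of_posDef h.posDef
  have hu : IsUnit A.det := isUnit_det_of_mul_transpose h.posDef hA
  obtain ⟨m, hm⟩ := h.exists_integral_sq_mul_sq h4 hA
  have hL := h.memLp_whiten h4 A
  -- Unit weights turn the weighted norm into `r²`, so `E[r⁴] = m (p² + 2p)`.
  have hκ : 1 + ellipticalKurtosis ν μ M = m := by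
    have h1 : ∀ x, radiusSq μ M x = ∑ i, (fun _ => (1 : ℝ)) i * whiten A μ x i ^ 2 := by
      intro x
      rw [radiusSq_eq_whiten hA]
      simp [dotProduct, sq]
    have hp0 : (p : ℝ) ≠ 0 := by positivity
    have hp2 : (p : ℝ) + 2 ≠ 0 := by positivity
    simp only [ellipticalKurtosis, h1]
    rw [integral_sq_sum_mul hL hm]
    simp
    field_simp
  have ht : M.trace = ∑ i, d i := by
    rw [← hA, Matrix.trace_mul_comm, hd, Matrix.trace_diagonal]
  have ht2 : (M ^ 2).trace = ∑ i, d i ^ 2 := by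
    rw [← hA, sq, Matrix.mul_assoc, Matrix.trace_mul_comm]
    simp only [Matrix.mul_assoc]
    rw [hd, ← Matrix.mul_assoc, hd, Matrix.diagonal_mul_diagonal, Matrix.trace_diagonal]
    simp only [sq]
  simp only [sum_sq_eq_whiten hu hd]
  rw [integral_sq_sum_mul hL hm, hκ, ht, ht2]

lemma IsElliptical.integral_radiusSq (h : IsElliptical ν μ M g) (h4 : MemLp id 4 ν) :
    Integrable (radiusSq μ M) ν ∧ ∫ x, radiusSq μ M x ∂ν = p := by
  have := h.isProbabilityMeasure
  have hexp : radiusSq μ M =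
      fun x => ∑ a, ∑ b, M⁻¹ a b * ((x a - μ a) * (x b - μ b)) := by
    ext x
    simp only [radiusSq, dotProduct, Matrix.mulVec, Pi.sub_apply, Finset.mul_sum]
    refine Finset.sum_congr rfl fun a _ => Finset.sum_congr rfl fun b _ => ?_
    ring
  have hint : ∀ a b, Integrable (fun x => M⁻¹ a b * ((x a - μ a) * (x b - μ b))) ν := by
    intro a b
    have h2 : ∀ c, MemLp (fun x : Fin p → ℝ => x c - μ c) 2 ν := fun c =>
      (memLp_coord_sub h4 c).mono_exponent (by norm_num)
    exact ((h2 a).integrable_mul (h2 b)).const_mul _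
  have hsum : Integrable (radiusSq μ M) ν := by
    rw [hexp]
    exact integrable_finsetSum _ fun a _ => integrable_finsetSum _ fun b _ => hint a b
  refine ⟨hsum, ?_⟩
  rw [hexp, integral_finsetSum _ fun a _ => integrable_finsetSum _ fun b _ => hint a b]
  have hsymm : ∀ a b, M a b = M b a := fun a b => by
    simpa using h.posDef.isHermitian.apply b a
  have hrow : ∀ a, ∫ x, ∑ b, M⁻¹ a b * ((x a - μ a) * (x b - μ b)) ∂ν = (M⁻¹ * M) a a := by
    intro a
    rw [integral_finsetSum _ fun b _ => hint a b, Matrix.mul_apply]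
    refine Finset.sum_congr rfl fun b _ => ?_
    rw [integral_const_mul, h.integral_sub_mul_sub, hsymm]
  simp only [hrow, Matrix.nonsing_inv_mul M (isUnit_iff_ne_zero.2 h.posDef.det_pos.ne')]
  simp

lemma IsElliptical.integrable_radiusSq_sq (h : IsElliptical ν μ M g) (h4 : MemLp id 4 ν) :
    Integrable (fun x => radiusSq μ M x ^ 2) ν := by
  obtain ⟨A, d, hA, hd⟩ := exists_factor_of_posDef h.posDef
  have hL := h.memLp_whiten h4 A
  simp only [radiusSq_eq_whiten hA, dotProduct, sq, Finset.sum_mul_sum]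
  exact integrable_finsetSum _ fun i _ => integrable_finsetSum _ fun j _ =>
    integrable_mul_mul_mul (hL i) (hL i) (hL j) (hL j)

/-- Since `E[r²] = p`, nonnegativity of the variance of `r²` gives `E[r⁴] ≥ p²`, so `κ ≥ -2/(p +
2)`; the worst case is `p = 1`. -/
lemma IsElliptical.neg_two_thirds_le_kurtosis (h : IsElliptical ν μ M g) (h4 : MemLp id 4 ν)
    (hp : 1 ≤ p) : -(2 / 3) ≤ ellipticalKurtosis ν μ M := by
  have := h.isProbabilityMeasure
  obtain ⟨hi, he⟩ := h.integral_radiusSq h4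
  have h2 := h.integrable_radiusSq_sq h4
  have hnn : 0 ≤ ∫ x, (radiusSq μ M x - p) ^ 2 ∂ν := integral_nonneg fun x => sq_nonneg _
  have hexp : ∀ x, (radiusSq μ M x - p) ^ 2
      = radiusSq μ M x ^ 2 - 2 * p * radiusSq μ M x + (p : ℝ) ^ 2 := fun x => by ring
  simp only [hexp] at hnn
  have h3 : Integrable (fun x => 2 * (p : ℝ) * radiusSq μ M x) ν := hi.const_mul _
  have h4 : Integrable (fun x => radiusSq μ M x ^ 2 - 2 * (p : ℝ) * radiusSq μ M x) ν := h2.sub h3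
  rw [integral_add h4 (integrable_const _), integral_sub h2 h3, integral_const_mul, he] at hnn
  simp at hnn
  have hp1 : (1 : ℝ) ≤ p := by exact_mod_cast hp
  have hpos : (0 : ℝ) < (p : ℝ) * (p + 2) := by positivity
  have hq : 1 / 3 ≤ (∫ x, radiusSq μ M x ^ 2 ∂ν) / ((p : ℝ) * (p + 2)) := by
    rw [le_div_iff₀ hpos]
    nlinarith
  rw [ellipticalKurtosis]
  linarith

end Elliptical

end EllipticalSCM

/-! ### Expectation of the estimator. -/

namespace EllipticalSCM

section Estimator

variable {n p : ℕ} {ν : Measure (Fin p → ℝ)} {μ : Fin p → ℝ} {M : Matrix (Fin p) (Fin p) ℝ}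
  {g : ℝ≥0 → ℝ≥0}

lemma trace_sq_eq_sum (S : Matrix (Fin p) (Fin p) ℝ) :
    (S ^ 2).trace = ∑ a, ∑ b, S a b * S b a := by
  simp [sq, Matrix.trace, Matrix.mul_apply]

lemma sq_trace_eq_sum (S : Matrix (Fin p) (Fin p) ℝ) :
    S.trace ^ 2 = ∑ a, ∑ b, S a a * S b b := by
  simp [sq, Matrix.trace, Finset.sum_mul_sum]

lemma sum_sum_add_mul_add_mul_sub (u v w q : Fin p → Fin p → ℝ) (c e : ℝ) :
    ∑ a, ∑ b, (u a b + c * (v a b + w a b) + e * (q a b - u a b - v a b - w a b))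
      = (∑ a, ∑ b, u a b) + c * ((∑ a, ∑ b, v a b) + ∑ a, ∑ b, w a b)
        + e * ((∑ a, ∑ b, q a b) - (∑ a, ∑ b, u a b) - (∑ a, ∑ b, v a b)
          - ∑ a, ∑ b, w a b) := by
  simp only [Finset.sum_add_distrib, ← Finset.mul_sum, Finset.sum_sub_distrib]

lemma integrable_trace_sampleCov_sq [IsProbabilityMeasure ν] (hn : 2 ≤ n) (h4 : MemLp id 4 ν) :
    Integrable (fun x : Fin n → Fin p → ℝ => (sampleCov x ^ 2).trace) (Measure.pi fun _ => ν) := by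
  simp only [trace_sq_eq_sum]
  exact integrable_finsetSum _ fun a _ => integrable_finsetSum _ fun b _ =>
    integrable_sampleCov_mul hn h4 a b b a

lemma integrable_sq_trace_sampleCov [IsProbabilityMeasure ν] (hn : 2 ≤ n) (h4 : MemLp id 4 ν) :
    Integrable (fun x : Fin n → Fin p → ℝ => (sampleCov x).trace ^ 2) (Measure.pi fun _ => ν) := by
  simp only [sq_trace_eq_sum]
  exact integrable_finsetSum _ fun a _ => integrable_finsetSum _ fun b _ =>
    integrable_sampleCov_mul hn h4 a a b b

lemma IsElliptical.sum_integral_sq_mul_sq (h : IsElliptical ν μ M g) (h4 : MemLp id 4 ν)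
    (hp : 1 ≤ p) :
    ∑ a, ∑ b, ∫ x, (x a - μ a) * (x a - μ a) * ((x b - μ b) * (x b - μ b)) ∂ν
      = (1 + ellipticalKurtosis ν μ M) * (M.trace ^ 2 + 2 * (M ^ 2).trace) := by
  have := h.isProbabilityMeasure
  have hint : ∀ a b, Integrable
      (fun x => (x a - μ a) * (x a - μ a) * ((x b - μ b) * (x b - μ b))) ν := fun a b =>
    integrable_mul_mul_mul (memLp_coord_sub h4 a) (memLp_coord_sub h4 a) (memLp_coord_sub h4 b)
      (memLp_coord_sub h4 b)
  rw [← h.integral_sq_sum_sq h4 hp]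
  simp only [sq, Finset.sum_mul_sum]
  rw [integral_finsetSum _ fun a _ => integrable_finsetSum _ fun b _ => hint a b]
  exact Finset.sum_congr rfl fun a _ => (integral_finsetSum _ fun b _ => hint a b).symm

/-- The mean of `tr(S²)`. -/
lemma IsElliptical.integral_trace_sampleCov_sq (h : IsElliptical ν μ M g) (h4 : MemLp id 4 ν)
    (hn : 2 ≤ n) (hp : 1 ≤ p) :
    ∫ x : Fin n → Fin p → ℝ, (sampleCov x ^ 2).trace ∂(Measure.pi fun _ => ν)
      = (M ^ 2).trace + ((n : ℝ) - 1)⁻¹ * ((M ^ 2).trace + M.trace ^ 2)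
        + (n : ℝ)⁻¹ * (ellipticalKurtosis ν μ M * (M.trace ^ 2 + 2 * (M ^ 2).trace)) := by
  have := h.isProbabilityMeasure
  have hcomm : ∀ a b, ∫ x, (x a - μ a) * (x b - μ b) * ((x b - μ b) * (x a - μ a)) ∂ν
      = ∫ x, (x a - μ a) * (x a - μ a) * ((x b - μ b) * (x b - μ b)) ∂ν := fun a b =>
    integral_congr_ae (ae_of_all _ fun x => by ring)
  have hint := fun a b => integrable_sampleCov_mul hn h4 a b b a
  have hmom := fun a b => integral_sampleCov_mul hn h4 (h.integral_sub_mean h4)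
    h.integral_sub_mul_sub a b b a
  simp only [hcomm] at hmom
  simp only [trace_sq_eq_sum (sampleCov _)]
  rw [integral_finsetSum _ fun a _ => integrable_finsetSum _ fun b _ => hint a b,
    Finset.sum_congr rfl fun a _ => (integral_finsetSum _ fun b _ => hint a b).trans
      (Finset.sum_congr rfl fun b _ => hmom a b)]
  rw [sum_sum_add_mul_add_mul_sub (fun a b => M a b * M b a) (fun a b => M a b * M b a)
    (fun a b => M a a * M b b), h.sum_integral_sq_mul_sq h4 hp, ← trace_sq_eq_sum,
    ← sq_trace_eq_sum]
  ring

/-- The mean of `tr(S)²`. -/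
lemma IsElliptical.integral_sq_trace_sampleCov (h : IsElliptical ν μ M g) (h4 : MemLp id 4 ν)
    (hn : 2 ≤ n) (hp : 1 ≤ p) :
    ∫ x : Fin n → Fin p → ℝ, (sampleCov x).trace ^ 2 ∂(Measure.pi fun _ => ν)
      = M.trace ^ 2 + ((n : ℝ) - 1)⁻¹ * (2 * (M ^ 2).trace)
        + (n : ℝ)⁻¹ * (ellipticalKurtosis ν μ M * (M.trace ^ 2 + 2 * (M ^ 2).trace)) := by
  have := h.isProbabilityMeasure
  have htr : ∑ a, ∑ b, M a b * M a b = (M ^ 2).trace := by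
    rw [trace_sq_eq_sum]
    refine Finset.sum_congr rfl fun a _ => Finset.sum_congr rfl fun b _ => ?_
    rw [show M b a = M a b by simpa using h.posDef.isHermitian.apply a b]
  have hint := fun a b => integrable_sampleCov_mul hn h4 a a b b
  have hmom := fun a b => integral_sampleCov_mul hn h4 (h.integral_sub_mean h4)
    h.integral_sub_mul_sub a a b b
  simp only [sq_trace_eq_sum (sampleCov _)]
  rw [integral_finsetSum _ fun a _ => integrable_finsetSum _ fun b _ => hint a b,
    Finset.sum_congr rfl fun a _ => (integral_finsetSum _ fun b _ => hint a b).trans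
      (Finset.sum_congr rfl fun b _ => hmom a b)]
  rw [sum_sum_add_mul_add_mul_sub (fun a b => M a a * M b b) (fun a b => M a b * M a b)
    (fun a b => M a b * M a b), h.sum_integral_sq_mul_sq h4 hp, htr, ← sq_trace_eq_sum]
  ring

/-- Here `s` stands for `(tr M)²` and `t` for `tr(M²)`. The ratio `a_n / n` is that of the
coefficients of `s` in the two expectations, so `s` cancels; `b_n` is the reciprocal of the
remaining coefficient of `t`. -/
lemma bCoef_mul_bias_correction {n : ℕ} (hn : 3 ≤ n) {κ : ℝ} (hκ : -(2 / 3) ≤ κ) (s t : ℝ) :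
    bCoef n κ * ((t + ((n : ℝ) - 1)⁻¹ * (t + s) + (n : ℝ)⁻¹ * (κ * (s + 2 * t)))
      - aCoef n κ * (n : ℝ)⁻¹ *
        (s + ((n : ℝ) - 1)⁻¹ * (2 * t) + (n : ℝ)⁻¹ * (κ * (s + 2 * t)))) = t := by
  have hn3 : (3 : ℝ) ≤ n := by exact_mod_cast hn
  have h0 : (n : ℝ) ≠ 0 := by positivity
  have h1 : (n : ℝ) - 1 ≠ 0 := by linarith
  have h2 : (n : ℝ) - 2 ≠ 0 := by linarith
  have h3 : κ + (n : ℝ) ≠ 0 := by linarith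
  have h3' : (n : ℝ) + κ ≠ 0 := by linarith
  -- By `κ ≥ -2/3` this is at least `n² - n + 2 > 0`.
  have h4 : 3 * κ * ((n : ℝ) - 1) + (n : ℝ) * ((n : ℝ) + 1) ≠ 0 := by nlinarith
  unfold bCoef aCoef
  generalize hD : 3 * κ * ((n : ℝ) - 1) + (n : ℝ) * ((n : ℝ) + 1) = D at h4
  field_simp
  rw [← hD]
  ring

theorem IsElliptical.integral_thetaHat {Ω : Type*} [MeasurableSpace Ω] {P : Measure Ω}
    [IsProbabilityMeasure P] {X : Fin n → Ω → Fin p → ℝ} (h : IsElliptical ν μ M g)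
    (h4 : MemLp id 4 ν) (hX : IsIIDSample P X ν) (hn : 3 ≤ n) (hp : 1 ≤ p) :
    Integrable (fun ω => thetaHat (ellipticalKurtosis ν μ M) (fun i => X i ω)) P ∧
      ∫ ω, thetaHat (ellipticalKurtosis ν μ M) (fun i => X i ω) ∂P = theta M := by
  have := h.isProbabilityMeasure
  have hn2 : 2 ≤ n := by omega
  have hlaw : HasLaw (fun ω i => X i ω) (Measure.pi fun _ : Fin n => ν) P :=
    hX.indep.hasLaw_pi hX.hasLaw
  have hp0 : (p : ℝ) ≠ 0 := by positivity
  have h1 := integrable_trace_sampleCov_sq hn2 h4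
  have h2 := integrable_sq_trace_sampleCov hn2 h4
  set κ := ellipticalKurtosis ν μ M with hκ
  have hform : (fun x : Fin n → Fin p → ℝ => thetaHat κ x) = fun x =>
      bCoef n κ / p * ((sampleCov x ^ 2).trace
        - aCoef n κ * (n : ℝ)⁻¹ * (sampleCov x).trace ^ 2) := by
    ext x
    unfold thetaHat
    field_simp
  have hint : Integrable (fun x : Fin n → Fin p → ℝ => thetaHat κ x) (Measure.pi fun _ => ν) := by
    rw [hform]
    exact (h1.sub (h2.const_mul _)).const_mul _
  refine ⟨?_, ?_⟩
  · rw [← hlaw.map_eq] at hint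
    exact hint.comp_aemeasurable hlaw.aemeasurable
  · refine (hlaw.integral_comp hint.aestronglyMeasurable).trans ?_
    rw [hform, integral_const_mul, integral_sub h1 (h2.const_mul _), integral_const_mul,
      h.integral_trace_sampleCov_sq h4 hn2 hp, h.integral_sq_trace_sampleCov h4 hn2 hp, theta,
      ← hκ, div_mul_eq_mul_div,
      bCoef_mul_bias_correction hn (h.neg_two_thirds_le_kurtosis h4 hp)]

end Estimator

end EllipticalSCM

theorem theorem4 :
    -- exact unbiasedness for every finite `n` and `p`
    (∀ {Ω : Type*} [MeasurableSpace Ω] (P : Measure Ω) [IsProbabilityMeasure P]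
      (n p : ℕ) (_ : 3 ≤ n) (_ : 1 ≤ p)
      (μ : Fin p → ℝ) (M : Matrix (Fin p) (Fin p) ℝ) (g : ℝ≥0 → ℝ≥0)
      (ν : Measure (Fin p → ℝ)) (X : Fin n → Ω → Fin p → ℝ),
      EllipticalSCM.IsElliptical ν μ M g →
      MemLp id 4 ν →
      EllipticalSCM.IsIIDSample P X ν →
      Integrable (fun ω => EllipticalSCM.thetaHat
        (EllipticalSCM.ellipticalKurtosis ν μ M) (fun i => X i ω)) P ∧
      ∫ ω, EllipticalSCM.thetaHat
        (EllipticalSCM.ellipticalKurtosis ν μ M) (fun i => X i ω) ∂P = EllipticalSCM.theta M)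
    ∧
    -- asymptotic unbiasedness when `n, p → ∞`, `p / n → c₀` and `tr(M ^ i) / p` converges
    (∀ {Ω : ℕ → Type*} [∀ k, MeasurableSpace (Ω k)] (P : ∀ k, Measure (Ω k))
      [∀ k, IsProbabilityMeasure (P k)]
      (n p : ℕ → ℕ)
      (μ : ∀ k, Fin (p k) → ℝ) (M : ∀ k, Matrix (Fin (p k)) (Fin (p k)) ℝ)
      (g : ℕ → ℝ≥0 → ℝ≥0)
      (ν : ∀ k, Measure (Fin (p k) → ℝ)) (X : ∀ k, Fin (n k) → Ω k → Fin (p k) → ℝ)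
      (c₀ : ℝ) (L : ℕ → ℝ),
      (∀ k, EllipticalSCM.IsElliptical (ν k) (μ k) (M k) (g k)) →
      (∀ k, MemLp id 4 (ν k)) →
      (∀ k, EllipticalSCM.IsIIDSample (P k) (X k) (ν k)) →
      Tendsto n atTop atTop →
      Tendsto p atTop atTop →
      Tendsto (fun k => (p k : ℝ) / (n k : ℝ)) atTop (𝓝 c₀) →
      (∀ i ∈ Finset.Icc 1 4, 0 < L i ∧
        Tendsto (fun k => (M k ^ i).trace / (p k : ℝ)) atTop (𝓝 (L i))) →
      (∀ᶠ k in atTop, Integrable (fun ω => EllipticalSCM.thetaHat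
        (EllipticalSCM.ellipticalKurtosis (ν k) (μ k) (M k)) (fun i => X k i ω)) (P k)) ∧
      Tendsto (fun k => ∫ ω, EllipticalSCM.thetaHat
        (EllipticalSCM.ellipticalKurtosis (ν k) (μ k) (M k)) (fun i => X k i ω) ∂(P k))
        atTop (𝓝 (L 2))) := by
  refine ⟨?_, ?_⟩
  · intro Ω _ P _ n p hn hp μ M g ν X h h4 hX
    exact h.integral_thetaHat h4 hX hn hp
  · intro Ω _ P _ n p μ M g ν X c₀ L h h4 hX hn hp _ hL
    -- The exact formula needs `n ≥ 3` and `p ≥ 1`, which may fail for finitely many `k`.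
    have hev : ∀ᶠ k in atTop, 3 ≤ n k ∧ 1 ≤ p k :=
      (hn.eventually_ge_atTop 3).and (hp.eventually_ge_atTop 1)
    refine ⟨?_, ?_⟩
    · filter_upwards [hev] with k hk
      exact ((h k).integral_thetaHat (h4 k) (hX k) hk.1 hk.2).1
    · refine (hL 2 (by simp)).2.congr' ?_
      filter_upwards [hev] with k hk
      exact ((h k).integral_thetaHat (h4 k) (hX k) hk.1 hk.2).2.symm
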